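/- A continuum is a nonempty compact connected metric space. For a continuum $G$ let $E(G)$ be the set of points having arbitrarily small neighborhoods $V$ with $\#\partial V=1$, and $B(G)$ the set of points $x$ such that every sufficiently small neighborhood $V$ of $x$ has $\#\partial V\ge 3$; $G$ is a tame graph if $E(G)\cup B(G)$ has countable closure. An arc is a set $\alpha\subset G$ homeomorphic to $[0,1]$; put $\alpha^\circ=\alpha\setminus E(\alpha)$, and call $\alpha$ free if $\alpha^\circ$ is open in $G$. A tame partition of $G$ is a countable (possibly finite) family $\mathcal P$ of free arcs whose sets $i^\circ$, $i\in\mathcal P$, are pairwise disjoint and which covers $G$ up to a countable set. It is a countable Markov partition for a map $g:G\to G$ if (i) for every $i\in\mathcal P$ the restriction $g|_i:i\to g(i)$ is a homeomorphism, and (ii) for all $i,j\in\mathcal P$, $g(i)\cap j^\circ\ne\emptyset$ implies $g(i)\supset j$. The associated transition matrix $M=(m_{ij})_{i,j\in\mathcal P}$ has $m_{ij}=1$ if $g(i)\supset j$ and $m_{ij}=0$ if $g(i)\cap j^\circ=\emptyset$. Let $\Sigma_M=\{\omega\in\mathcal P^{\{0,1,2,\dots\}}: m_{\omega_n\omega_{n+1}}=1\text{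 for all }n\ge 0\}$, with the topology induced from the product of discrete spaces, and let $\sigma$ be the left shift, $(\sigma\omega)_n=\omega_{n+1}$. A map $g$ is mixing if for all nonempty open $U,V\subset G$ there is $N\ge 0$ with $g^n(U)\cap V\neq\emptyset$ for all $n\ge N$. **Theorem.** Let $G$ be a tame graph, $g:G\to G$ a continuous mixing map with countable Markov partition $\mathcal P$, and let $M$ be the associated transition matrix. Then $(G,g)$ and $(\Sigma_M,\sigma)$ are isomorphic modulo countable invariant sets: there exist countable sets $N_1\subset G$ and $N_2\subset\Sigma_M$ with $g^{-1}(N_1)=N_1$ and $\sigma^{-1}(N_2)=N_2$, and a bijection $\psi:G\setminus N_1\to\Sigma_M\setminus N_2$, measurable in both directions with respect to the Borel $\sigma$-algebras, such that $\sigma\circ\psi=\psi\circ g$ on $G\setminus N_1$. -/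

import Mathlib

open Set Filter Topology

namespace TameGraph

/-- The endpoints of a space: points with arbitrarily small neighbourhoods whose boundary
consists of exactly one point. -/
def endpointSet (X : Type*) [TopologicalSpace X] : Set X :=
  {x | ∀ U ∈ 𝓝 x, ∃ V ∈ 𝓝 x, V ⊆ U ∧ (frontier V).encard = 1}

/-- The branching points of a space: points all of whose sufficiently small neighbourhoods have
at least three boundary points. -/
def branchSet (X : Type*) [TopologicalSpace X] : Set X :=
  {x | ∃ U ∈ 𝓝 x, ∀ V ∈ 𝓝 x, V ⊆ U → 3 ≤ (frontier V).encard}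

/-- A tame graph is a continuum (nonempty compact connected metric space) in which the closure of
the set of endpoints and branching points is countable. -/
def IsTameGraph (G : Type*) [MetricSpace G] : Prop :=
  CompactSpace G ∧ ConnectedSpace G ∧ (closure (endpointSet G ∪ branchSet G)).Countable

section Partitions

variable {G : Type*} [TopologicalSpace G]

/-- An arc is a subset homeomorphic to the closed unit interval. -/
def IsArc (α : Set G) : Prop := Nonempty (unitInterval ≃ₜ α)

/-- `α° = α \ E(α)`, where `E(α)` is the set of endpoints of the space `α`. -/
def arcInterior (α : Set G) : Set G := α \ Subtype.val '' endpointSet α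

/-- A free arc is an arc `α` for which `α°` is open in the ambient space. -/
def IsFreeArc (α : Set G) : Prop := IsArc α ∧ IsOpen (arcInterior α)

/-- A tame partition: a countable family of free arcs with pairwise disjoint interiors covering
the space up to a countable set of points. -/
structure IsTamePartition (P : Set (Set G)) : Prop where
  countable : P.Countable
  free : ∀ i ∈ P, IsFreeArc i
  disjoint : P.PairwiseDisjoint arcInterior
  cover : ((⋃₀ P)ᶜ).Countable

/-- A countable Markov partition for `g`. That `g|_i : i → g(i)` is a homeomorphism is expressed
by saying that `g|_i` is a topological embedding. -/
structure IsCountableMarkovPartition (g : G → G) (P : Set (Set G)) : Prop where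
  tame : IsTamePartition P
  homeo : ∀ i ∈ P, IsEmbedding (i.domRestrict g)
  markov : ∀ i ∈ P, ∀ j ∈ P, (g '' i ∩ arcInterior j).Nonempty → j ⊆ g '' i

/-- Topological mixing. -/
def IsMixing (g : G → G) : Prop :=
  ∀ U V : Set G, IsOpen U → IsOpen V → U.Nonempty → V.Nonempty →
    ∃ N : ℕ, ∀ n ≥ N, (g^[n] '' U ∩ V).Nonempty

open Classical in
/-- The transition matrix: `m_{ij} = 1` if `g(i) ⊇ j`, and `m_{ij} = 0` otherwise. For a countable
Markov partition the second case is `g(i) ∩ j° = ∅`, see `transitionMatrix_eq_zero_iff`. -/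
noncomputable def transitionMatrix (g : G → G) (P : Set (Set G)) : Matrix P P ℕ :=
  fun i j => if (j : Set G) ⊆ g '' (i : Set G) then 1 else 0

end Partitions

section Shift

variable {I : Type*}

/-- The one-sided shift space `Σ_M` of a 0-1 matrix `M`. -/
def MarkovShift (M : Matrix I I ℕ) : Type _ := {ω : ℕ → I // ∀ n, M (ω n) (ω (n + 1)) = 1}

/-- `Σ_M` carries the subspace topology of the product of discrete spaces. -/
instance (M : Matrix I I ℕ) : TopologicalSpace (MarkovShift M) :=
  TopologicalSpace.induced Subtype.val (@Pi.topologicalSpace ℕ (fun _ => I) (fun _ => ⊥))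

/-- The left shift on `Σ_M`. -/
def shiftMap (M : Matrix I I ℕ) (ω : MarkovShift M) : MarkovShift M :=
  ⟨fun n => ω.1 (n + 1), fun n => ω.2 (n + 1)⟩

end Shift

/-- The restriction of `f` to the complement of a totally invariant set. -/
def restrictCompl {X : Type*} (f : X → X) {N : Set X} (h : f ⁻¹' N = N) (x : (Nᶜ : Set X)) :
    (Nᶜ : Set X) :=
  ⟨f x, fun hx => x.2 (h.subset hx)⟩

/-- Two systems are isomorphic modulo countable invariant sets if, after deleting countable totally
invariant sets, they are conjugate by a bijection that is measurable in both directions for the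
Borel sigma-algebras. -/
def IsomorphicModCountable {X₁ X₂ : Type*} [TopologicalSpace X₁] [TopologicalSpace X₂]
    (f₁ : X₁ → X₁) (f₂ : X₂ → X₂) : Prop :=
  ∃ (N₁ : Set X₁) (N₂ : Set X₂) (h₁ : f₁ ⁻¹' N₁ = N₁) (h₂ : f₂ ⁻¹' N₂ = N₂)
    (ψ : (N₁ᶜ : Set X₁) ≃ (N₂ᶜ : Set X₂)),
    N₁.Countable ∧ N₂.Countable ∧
    @Measurable _ _ (borel (N₁ᶜ : Set X₁)) (borel (N₂ᶜ : Set X₂)) ψ ∧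
    @Measurable _ _ (borel (N₂ᶜ : Set X₂)) (borel (N₁ᶜ : Set X₁)) ψ.symm ∧
    restrictCompl f₂ h₂ ∘ ψ = ψ ∘ restrictCompl f₁ h₁

/-! The two cases in the definition of the transition matrix are exhaustive and exclusive. -/

theorem inter_frontier_nonempty {X : Type*} [TopologicalSpace X] {S V : Set X}
    (hS : IsPreconnected S) {x y : X} (hx : x ∈ S) (hxV : V ∈ 𝓝 x) (hy : y ∈ S) (hyV : y ∉ V) :
    (S ∩ frontier V).Nonempty := by
  by_contra hne
  have hsub : S ⊆ interior V ∪ (closure V)ᶜ := fun z hz => by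
    by_cases h1 : z ∈ interior V
    · exact Or.inl h1
    · exact Or.inr fun h2 => hne ⟨z, hz, h2, h1⟩
  have := hS.subset_left_of_subset_union isOpen_interior isClosed_closure.isOpen_compl
    (disjoint_left.2 fun z h1 h2 => h2 (subset_closure (interior_subset h1))) hsub
    ⟨x, hx, mem_interior_iff_mem_nhds.2 hxV⟩
  exact hyV (interior_subset (this hy))

theorem endpointSet_unitInterval : endpointSet unitInterval = {0, 1} := by
  ext x
  constructor
  · intro hx
    by_contra hne
    simp only [mem_insert_iff, mem_singleton_iff, not_or] at hne
    have hU : ({0, 1}ᶜ : Set unitInterval) ∈ 𝓝 x :=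
      (Set.toFinite _).isClosed.isOpen_compl.mem_nhds (by simp [hne])
    obtain ⟨V, hV, hVU, hc⟩ := hx _ hU
    obtain ⟨p, hp⟩ := encard_eq_one.1 hc
    have hxV := mem_of_mem_nhds hV
    have h0 : (0 : unitInterval) ∉ V := fun h => by simpa using hVU h
    have h1 : (1 : unitInterval) ∉ V := fun h => by simpa using hVU h
    obtain ⟨a, ha, hap⟩ := inter_frontier_nonempty
      (isPreconnected_Icc : IsPreconnected (Icc (0 : unitInterval) x))
      ⟨x.2.1, le_rfl⟩ hV ⟨le_rfl, x.2.1⟩ h0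
    obtain ⟨b, hb, hbp⟩ := inter_frontier_nonempty
      (isPreconnected_Icc : IsPreconnected (Icc x (1 : unitInterval)))
      ⟨le_rfl, x.2.2⟩ hV ⟨x.2.2, le_rfl⟩ h1
    have hab : a = b := by rw [hp] at hap hbp; exact hap.trans hbp.symm
    have hax : a = x := le_antisymm ha.2 (hab ▸ hb.1)
    exact hap.2 (hax ▸ mem_interior_iff_mem_nhds.2 hV)
  · rintro (rfl | rfl) U hU
    · obtain ⟨e, he, heU⟩ := exists_Ico_subset_of_mem_nhds hU ⟨1, zero_lt_one⟩
      refine ⟨Iio e, Iio_mem_nhds he, fun y hy => heU ⟨y.2.1, hy⟩, ?_⟩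
      rw [frontier_Iio' (a := e) ⟨(0 : unitInterval), he⟩, encard_singleton]
    · obtain ⟨e, he, heU⟩ := exists_Ioc_subset_of_mem_nhds hU ⟨0, zero_lt_one⟩
      refine ⟨Ioi e, Ioi_mem_nhds he, fun y hy => heU ⟨hy, y.2.2⟩, ?_⟩
      rw [frontier_Ioi' (a := e) ⟨(1 : unitInterval), he⟩, encard_singleton]

theorem image_endpointSet_subset {X Y : Type*} [TopologicalSpace X] [TopologicalSpace Y]
    (e : X ≃ₜ Y) : e '' endpointSet X ⊆ endpointSet Y := by
  rintro _ ⟨x, hx, rfl⟩ U hU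
  obtain ⟨V, hV, hVU, hc⟩ := hx (e ⁻¹' U) (e.continuous.continuousAt hU)
  refine ⟨e '' V, e.isOpenMap.image_mem_nhds hV, image_subset_iff.2 hVU, ?_⟩
  rw [← e.image_frontier, e.injective.encard_image, hc]

theorem arcInterior_eq {G : Type*} [TopologicalSpace G] {α : Set G} (e : unitInterval ≃ₜ α) :
    arcInterior α = (fun t => (e t : G)) '' Ioo 0 1 := by
  have key : endpointSet α = {e 0, e 1} := by
    apply Subset.antisymm
    · intro y hy
      have := image_endpointSet_subset e.symm (mem_image_of_mem _ hy)
      rw [endpointSet_unitInterval] at this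
      rcases this with h | h
      · exact Or.inl (by rw [← h, e.apply_symm_apply])
      · exact Or.inr (by rw [mem_singleton_iff, ← (h : e.symm y = 1), e.apply_symm_apply])
    · have := image_endpointSet_subset e
      rwa [endpointSet_unitInterval, image_pair] at this
  ext x
  constructor
  · rintro ⟨hx, hne⟩
    refine ⟨e.symm ⟨x, hx⟩, ⟨?_, ?_⟩, by simp⟩
    · refine unitInterval.pos_iff_ne_zero.2 fun h => hne ⟨⟨x, hx⟩, ?_, rfl⟩
      rw [key, ← h]; simp
    · refine unitInterval.lt_one_iff_ne_one.2 fun h => hne ⟨⟨x, hx⟩, ?_, rfl⟩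
      rw [key, ← h]; simp
  · rintro ⟨t, ht, rfl⟩
    refine ⟨(e t).2, ?_⟩
    rintro ⟨y, hy, hyt⟩
    rw [key] at hy
    have hy' := Subtype.ext hyt
    rcases hy with h | h
    · exact ht.1.ne (e.injective (h.symm.trans hy'))
    · exact ht.2.ne (e.injective (hy'.symm.trans h))

theorem transitionMatrix_eq_zero_iff {G : Type*} [TopologicalSpace G] {g : G → G}
    {P : Set (Set G)} (hP : IsCountableMarkovPartition g P) (i j : P) :
    transitionMatrix g P i j = 0 ↔ g '' (i : Set G) ∩ arcInterior (j : Set G) = ∅ := by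
  have h0 : transitionMatrix g P i j = 0 ↔ ¬ (j : Set G) ⊆ g '' (i : Set G) := by
    simp [transitionMatrix]
  rw [h0, ← not_nonempty_iff_eq_empty, not_iff_not]
  refine ⟨fun h => ?_, hP.markov _ i.2 _ j.2⟩
  obtain ⟨e⟩ := (hP.tame.free _ j.2).1
  obtain ⟨t, ht⟩ := exists_between (zero_lt_one (α := unitInterval))
  exact ⟨e t, h (e t).2, by rw [arcInterior_eq e]; exact ⟨t, ht, rfl⟩⟩

end TameGraph

/-! The coding is built from the symbolic side: each `ω` in the shift is followed by exactly one
point `π ω`, meaning that `g^[n] (π ω)` lies in the arc `ω n` for all `n`. Existence is compactness,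
since the Markov property makes the closed nested cylinders nonempty.

Uniqueness (`follows_unique`) is where mixing enters. In the parameter of the first arc the
followers of `ω` form an interval. If it is nondegenerate, its interior is open in `G` and meets its
own image at all large times, so `ω` is eventually constant. Then `g` acts injectively on an
interval, and the monotone map `g^[2]` traps one side of a point, against mixing.

Hence `π` is a continuous semiconjugacy. A point whose orbit stays in the open arcs has just one
itinerary, so it suffices to delete the grand orbit of the countable rest and its preimage under
`π`. The former is countable because `g` is injective on each arc, the latter because every point
has countably many itineraries (`countable_follows`). -/

namespace TameGraph

/-! ### Arcs of a tame partition and how they meet -/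

section Arcs

variable {G : Type*} [TopologicalSpace G] {P : Set (Set G)}

/-- A parametrization of a member of a tame partition by the unit interval. -/
noncomputable def IsTamePartition.param (hP : IsTamePartition P) (i : P) (t : unitInterval) : G :=
  Classical.choice (hP.free i i.2).1 t

namespace IsTamePartition

variable (hP : IsTamePartition P)
include hP

theorem continuous_param (i : P) : Continuous (hP.param i) :=
  continuous_subtype_val.comp (Classical.choice (hP.free i i.2).1).continuous

theorem injective_param (i : P) : Function.Injective (hP.param i) :=
  Subtype.val_injective.comp (Classical.choice (hP.free i i.2).1).injective

theorem param_mem (i : P) (t : unitInterval) : hP.param i t ∈ (i : Set G) :=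
  (Classical.choice (hP.free i i.2).1 t).2

theorem exists_param_eq {i : P} {x : G} (hx : x ∈ (i : Set G)) : ∃ t, hP.param i t = x :=
  ⟨(Classical.choice (hP.free i i.2).1).symm ⟨x, hx⟩, by simp [param]⟩

theorem arcInterior_eq_image (i : P) : arcInterior (i : Set G) = hP.param i '' Ioo 0 1 :=
  arcInterior_eq _

theorem param_mem_arcInterior {i : P} {t : unitInterval} :
    hP.param i t ∈ arcInterior (i : Set G) ↔ t ∈ Ioo 0 1 := by
  rw [hP.arcInterior_eq_image, (hP.injective_param i).mem_set_image]

theorem isOpen_arcInterior (i : P) : IsOpen (arcInterior (i : Set G)) := (hP.free i i.2).2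

/-- This is what freeness of the arcs provides: subintervals away from the endpoints are open in
`G`, so mixing applies to them. -/
theorem isOpen_param_image (i : P) {V : Set unitInterval} (hV : IsOpen V) (hV' : V ⊆ Ioo 0 1) :
    IsOpen (hP.param i '' V) := by
  have h := (Classical.choice (hP.free i i.2).1).isOpenMap V hV
  obtain ⟨O, hO, hOV⟩ := isOpen_induced_iff.1 h
  have : hP.param i '' V = arcInterior (i : Set G) ∩ O := by
    ext x
    constructor
    · rintro ⟨t, ht, rfl⟩
      refine ⟨hP.param_mem_arcInterior.2 (hV' ht), ?_⟩
      exact (hOV.symm.subset (mem_image_of_mem _ ht) :)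
    · rw [hP.arcInterior_eq_image]
      rintro ⟨⟨t, -, rfl⟩, hx⟩
      obtain ⟨s, hs, hst⟩ := hOV.subset (show Classical.choice (hP.free i i.2).1 t ∈ _ from hx)
      exact ⟨s, hs, congrArg Subtype.val hst⟩
  rw [this]
  exact (hP.isOpen_arcInterior i).inter hO

theorem finite_diff_arcInterior (i : P) : ((i : Set G) \ arcInterior (i : Set G)).Finite := by
  refine (Set.toFinite {hP.param i 0, hP.param i 1}).subset ?_
  rintro x ⟨hx, hx'⟩
  obtain ⟨t, rfl⟩ := hP.exists_param_eq hx
  rw [hP.param_mem_arcInterior] at hx'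
  by_cases h0 : t = 0
  · simp [h0]
  by_cases h1 : t = 1
  · simp [h1]
  exact absurd ⟨unitInterval.pos_iff_ne_zero.2 h0, unitInterval.lt_one_iff_ne_one.2 h1⟩ hx'

theorem eq_of_infinite_inter {i j : P} (h : ((i : Set G) ∩ j).Infinite) : i = j := by
  by_contra hij
  have hd := hP.disjoint i.2 j.2 (fun h => hij (Subtype.ext h))
  refine h (((hP.finite_diff_arcInterior i).union (hP.finite_diff_arcInterior j)).subset ?_)
  rintro x ⟨hi, hj⟩
  by_cases hx : x ∈ arcInterior (i : Set G)
  · exact Or.inr ⟨hj, fun hx' => disjoint_left.1 hd hx hx'⟩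
  · exact Or.inl ⟨hi, hx⟩

/-- Since `j°` is open, an arc through one of its points meets it in infinitely many points, while
distinct arcs share only endpoints. -/
theorem eq_of_mem_of_mem_arcInterior {i j : P} {x : G} (hi : x ∈ (i : Set G))
    (hj : x ∈ arcInterior (j : Set G)) : i = j := by
  obtain ⟨t, rfl⟩ := hP.exists_param_eq hi
  have hO : IsOpen (hP.param i ⁻¹' arcInterior (j : Set G)) :=
    (hP.isOpen_arcInterior j).preimage (hP.continuous_param i)
  have hinf := infinite_of_mem_nhds t (hO.mem_nhds hj)
  refine hP.eq_of_infinite_inter ((hinf.image (hP.injective_param i).injOn).mono ?_)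
  rintro _ ⟨s, hs, rfl⟩
  exact ⟨hP.param_mem i s, hs.1⟩

theorem countable_compl_iUnion_arcInterior : (⋃ i : P, arcInterior (i : Set G))ᶜ.Countable := by
  have := hP.countable.to_subtype
  refine (hP.cover.union (countable_iUnion fun i : P =>
    (hP.finite_diff_arcInterior i).countable)).mono fun x hx => ?_
  by_cases h : x ∈ ⋃₀ P
  · obtain ⟨i, hi, hxi⟩ := h
    exact Or.inr (mem_iUnion.2 ⟨⟨i, hi⟩, hxi, fun h' => hx (mem_iUnion.2 ⟨⟨i, hi⟩, h'⟩)⟩)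
  · exact Or.inl h

end IsTamePartition

end Arcs

/-! ### Itineraries and cylinders -/

section Itineraries

variable {G : Type*} {P : Set (Set G)} {g : G → G}

theorem transitionMatrix_eq_one_iff (i j : P) :
    transitionMatrix g P i j = 1 ↔ (j : Set G) ⊆ g '' (i : Set G) := by
  simp [transitionMatrix]

/-- The set of points following the itinerary `ω` up to time `n`. -/
def cylinder (g : G → G) (ω : MarkovShift (transitionMatrix g P)) (n : ℕ) : Set G :=
  {x | ∀ m ≤ n, g^[m] x ∈ (ω.1 m : Set G)}

/-- The point `x` follows the itinerary `ω`. -/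
def Follows (g : G → G) (ω : MarkovShift (transitionMatrix g P)) (x : G) : Prop :=
  ∀ n, g^[n] x ∈ (ω.1 n : Set G)

theorem Follows.shift {ω : MarkovShift (transitionMatrix g P)} {x : G} (h : Follows g ω x) :
    Follows g (shiftMap _ ω) (g x) := fun n => h (n + 1)

/-- A point of the shifted cylinder lies in the second arc, which the image of the first arc
contains, so it can be pulled back. -/
theorem cylinder_nonempty (hne : ∀ i : P, (i : Set G).Nonempty)
    (ω : MarkovShift (transitionMatrix g P)) (n : ℕ) : (cylinder g ω n).Nonempty := by
  induction n generalizing ω with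
  | zero =>
    obtain ⟨x, hx⟩ := hne (ω.1 0)
    exact ⟨x, fun m hm => by obtain rfl := Nat.le_zero.1 hm; exact hx⟩
  | succ n ih =>
    obtain ⟨y, hy⟩ := ih (shiftMap _ ω)
    obtain ⟨x, hx, rfl⟩ := (transitionMatrix_eq_one_iff _ _).1 (ω.2 0) (hy 0 (Nat.zero_le n))
    refine ⟨x, fun m hm => ?_⟩
    cases m with
    | zero => exact hx
    | succ m => exact hy m (Nat.le_of_succ_le_succ hm)

theorem antitone_cylinder (ω : MarkovShift (transitionMatrix g P)) :
    Antitone (cylinder g ω) := fun _ _ hnm _ hx k hk => hx k (hk.trans hnm)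

theorem follows_iff_mem_iInter {ω : MarkovShift (transitionMatrix g P)} {x : G} :
    Follows g ω x ↔ x ∈ ⋂ n, cylinder g ω n := by
  simp only [mem_iInter]
  exact ⟨fun h n m _ => h m, fun h n => h n n le_rfl⟩

theorem iterate_shiftMap_apply (ω : MarkovShift (transitionMatrix g P)) (n k : ℕ) :
    ((shiftMap _)^[n] ω).1 k = ω.1 (k + n) := by
  induction n generalizing ω with
  | zero => rfl
  | succ n ih => rw [Function.iterate_succ_apply, ih]; rfl

theorem Follows.iterate {ω : MarkovShift (transitionMatrix g P)} {x : G} (h : Follows g ω x)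
    (n : ℕ) : Follows g ((shiftMap _)^[n] ω) (g^[n] x) := by
  induction n generalizing ω x with
  | zero => exact h
  | succ n ih => exact ih h.shift

end Itineraries

/-! ### Existence, uniqueness and multiplicity of the coding -/

section Markov

variable {G : Type*} [TopologicalSpace G] {P : Set (Set G)} {g : G → G}

namespace IsCountableMarkovPartition

variable (hP : IsCountableMarkovPartition g P)
include hP

theorem injOn (i : P) : InjOn g (i : Set G) :=
  injOn_iff_injective.2 (hP.homeo i i.2).injective

theorem transitionMatrix_eq_one_of_mem {i j : P} {x : G} (hi : x ∈ (i : Set G))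
    (hj : g x ∈ arcInterior (j : Set G)) : transitionMatrix g P i j = 1 :=
  (transitionMatrix_eq_one_iff i j).2 (hP.markov i i.2 j j.2 ⟨g x, mem_image_of_mem _ hi, hj⟩)

/-- The inverse branch of `g` on a transition `i → j`, in the parameters of the arcs. -/
theorem exists_branch [T2Space G] (hg : Continuous g) {i j : P}
    (hij : transitionMatrix g P i j = 1) :
    ∃ φ : unitInterval → unitInterval, Continuous φ ∧ Function.Injective φ ∧
      ∀ s t, φ s = t ↔ g (hP.tame.param i t) = hP.tame.param j s := by
  have hinj : Function.Injective (g ∘ hP.tame.param i) := fun s t h =>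
    hP.tame.injective_param i (hP.injOn i (hP.tame.param_mem i s) (hP.tame.param_mem i t) h)
  have hemb := ((hg.comp (hP.tame.continuous_param i)).isClosedEmbedding hinj).isEmbedding
  have hex : ∀ t, ∃ s, g (hP.tame.param i s) = hP.tame.param j t := fun t => by
    obtain ⟨x, hx, hxt⟩ := (transitionMatrix_eq_one_iff i j).1 hij (hP.tame.param_mem j t)
    obtain ⟨s, rfl⟩ := hP.tame.exists_param_eq hx
    exact ⟨s, hxt⟩
  choose φ hφ using hex
  refine ⟨φ, ?_, fun s t h => hP.tame.injective_param j (by rw [← hφ, ← hφ, h]), fun s t => ?_⟩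
  -- `g ∘ param i` is an embedding (compact to Hausdorff), and composing it with `φ` gives `param
  -- j`.
  · rw [hemb.continuous_iff]
    exact (hP.tame.continuous_param j).congr fun t => (hφ t).symm
  · exact ⟨fun h => h ▸ hφ s, fun h => hinj ((hφ s).trans h.symm)⟩

/-- The inverse branch is strictly monotone, so it cannot send an interior parameter to 0 or 1. -/
theorem mem_arcInterior_of_map_mem [T2Space G] (hg : Continuous g) {i j : P}
    (hij : transitionMatrix g P i j = 1) {x : G} (hi : x ∈ (i : Set G))
    (hj : g x ∈ arcInterior (j : Set G)) : x ∈ arcInterior (i : Set G) := by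
  obtain ⟨φ, hφc, hφi, hφ⟩ := hP.exists_branch hg hij
  obtain ⟨t, rfl⟩ := hP.tame.exists_param_eq hi
  obtain ⟨s, hs, hst⟩ := (hP.tame.arcInterior_eq_image j).subset hj
  have hφs := (hφ s t).2 hst.symm
  rw [hP.tame.param_mem_arcInterior, ← hφs]
  rcases hφc.strictMono_of_inj hφi with h | h
  · exact ⟨(φ 0).2.1.trans_lt (h hs.1), (h hs.2).trans_le (φ 1).2.2⟩
  · exact ⟨(φ 1).2.1.trans_lt (h hs.2), (h hs.1).trans_le (φ 0).2.2⟩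

/-- The image of an endpoint of `i` lies in at most one successor of `i`. -/
theorem successor_unique [T2Space G] (hg : Continuous g) {i j k : P}
    (hij : transitionMatrix g P i j = 1) (hik : transitionMatrix g P i k = 1) {x : G}
    (hi : x ∈ (i : Set G)) (hx : x ∉ arcInterior (i : Set G)) (hj : g x ∈ (j : Set G))
    (hk : g x ∈ (k : Set G)) : j = k := by
  obtain ⟨φ, hφc, hφi, hφ⟩ := hP.exists_branch hg hij
  obtain ⟨χ, hχc, hχi, hχ⟩ := hP.exists_branch hg hik
  obtain ⟨t, rfl⟩ := hP.tame.exists_param_eq hi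
  obtain ⟨a, ha⟩ := hP.tame.exists_param_eq hj
  obtain ⟨b, hb⟩ := hP.tame.exists_param_eq hk
  have hat := (hφ a t).2 ha.symm
  have hbt := (hχ b t).2 hb.symm
  obtain ⟨c, hc⟩ := exists_ne (a : unitInterval)
  obtain ⟨d, hd⟩ := exists_ne (b : unitInterval)
  have hct : φ c ≠ t := fun h => hc (hφi (h.trans hat.symm))
  have hdt : χ d ≠ t := fun h => hd (hχi (h.trans hbt.symm))
  have hJ : (range φ).OrdConnected := (isPreconnected_range hφc).ordConnected
  have hK : (range χ).OrdConnected := (isPreconnected_range hχc).ordConnected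
  -- Both ranges are nondegenerate intervals containing the same end `t` of the unit interval, so
  -- they overlap in an interval.
  have key : (range φ ∩ range χ).Infinite := by
    rw [hP.tame.param_mem_arcInterior] at hx
    by_cases h0 : t = 0
    · have hpos : t < min (φ c) (χ d) := by
        rw [h0] at hct hdt ⊢
        exact lt_min (unitInterval.pos_iff_ne_zero.2 hct) (unitInterval.pos_iff_ne_zero.2 hdt)
      refine (Icc_infinite hpos).mono fun u hu => ⟨?_, ?_⟩
      · exact hJ.out ⟨a, hat⟩ ⟨c, rfl⟩ ⟨hu.1, hu.2.trans (min_le_left _ _)⟩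
      · exact hK.out ⟨b, hbt⟩ ⟨d, rfl⟩ ⟨hu.1, hu.2.trans (min_le_right _ _)⟩
    · have h1 : t = 1 := by
        by_contra h1
        exact hx ⟨unitInterval.pos_iff_ne_zero.2 h0, unitInterval.lt_one_iff_ne_one.2 h1⟩
      have hlt : max (φ c) (χ d) < t := by
        rw [h1] at hct hdt ⊢
        exact max_lt (unitInterval.lt_one_iff_ne_one.2 hct) (unitInterval.lt_one_iff_ne_one.2 hdt)
      refine (Icc_infinite hlt).mono fun u hu => ⟨?_, ?_⟩
      · exact hJ.out ⟨c, rfl⟩ ⟨a, hat⟩ ⟨(le_max_left _ _).trans hu.1, hu.2⟩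
      · exact hK.out ⟨d, rfl⟩ ⟨b, hbt⟩ ⟨(le_max_right _ _).trans hu.1, hu.2⟩
  have hinj : Function.Injective (g ∘ hP.tame.param i) := fun s t h =>
    hP.tame.injective_param i (hP.injOn i (hP.tame.param_mem i s) (hP.tame.param_mem i t) h)
  refine hP.tame.eq_of_infinite_inter ((key.image hinj.injOn).mono ?_)
  rintro _ ⟨_, ⟨⟨p, rfl⟩, ⟨q, hq⟩⟩, rfl⟩
  refine ⟨?_, ?_⟩
  · rw [Function.comp_apply, (hφ p _).1 rfl]
    exact hP.tame.param_mem j p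
  · rw [Function.comp_apply, (hχ q _).1 hq]
    exact hP.tame.param_mem k q

theorem countable_preimage {S : Set G} (hS : S.Countable) : (g ⁻¹' S).Countable := by
  have := hP.tame.countable.to_subtype
  have hi : ∀ i : P, ((i : Set G) ∩ g ⁻¹' S).Countable := fun i =>
    MapsTo.countable_of_injOn (f := g) (fun x hx => hx.2)
      ((hP.injOn i).mono inter_subset_left) hS
  refine (hP.tame.cover.union (countable_iUnion hi)).mono fun x hx => ?_
  by_cases h : x ∈ ⋃₀ P
  · obtain ⟨i, hi, hxi⟩ := h
    exact Or.inr (mem_iUnion.2 ⟨⟨i, hi⟩, hxi, hx⟩)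
  · exact Or.inl h

theorem countable_iterate_preimage {S : Set G} (hS : S.Countable) (n : ℕ) :
    (g^[n] ⁻¹' S).Countable := by
  induction n with
  | zero => exact hS
  | succ n ih =>
    rw [Function.iterate_succ, preimage_comp]
    exact hP.countable_preimage ih

/-- Sort itineraries by the first time `n` at which the orbit is not interior to its arc. Earlier
symbols are forced by interiority. Afterwards the orbit never becomes interior again, so
`successor_unique` forces each next symbol. The pair of `n` and the symbol at `n` thus determines
`ω`. -/
theorem countable_follows [T2Space G] (hg : Continuous g) (x : G) :
    {ω : MarkovShift (transitionMatrix g P) | Follows g ω x}.Countable := by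
  have := hP.tame.countable.to_subtype
  have hint : ∀ {ω ω' : MarkovShift (transitionMatrix g P)}, Follows g ω x → Follows g ω' x →
      ∀ n, g^[n] x ∈ arcInterior (ω.1 n : Set G) → ω.1 n = ω'.1 n := fun h h' n hn =>
    (hP.tame.eq_of_mem_of_mem_arcInterior (h' n) hn).symm
  have hback : ∀ {ω : MarkovShift (transitionMatrix g P)}, Follows g ω x → ∀ n k,
      g^[n + k] x ∈ arcInterior (ω.1 (n + k) : Set G) → g^[n] x ∈ arcInterior (ω.1 n : Set G) := by
    intro ω h n k
    induction k with
    | zero => exact id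
    | succ k ih =>
      intro hk
      refine ih (hP.mem_arcInterior_of_map_mem hg (ω.2 (n + k)) (h _) ?_)
      rwa [← Function.iterate_succ_apply' g]
  have hfwd : ∀ {ω ω' : MarkovShift (transitionMatrix g P)}, Follows g ω x → Follows g ω' x →
      ∀ n, ω.1 n = ω'.1 n → g^[n] x ∉ arcInterior (ω.1 n : Set G) →
      ∀ k, ω.1 (n + k) = ω'.1 (n + k) := by
    intro ω ω' h h' n hn hx k
    induction k with
    | zero => exact hn
    | succ k ih =>
      have h1 := h (n + k + 1)
      have h2 := h' (n + k + 1)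
      rw [Function.iterate_succ_apply'] at h1 h2
      exact hP.successor_unique hg (ω.2 (n + k)) (ih ▸ ω'.2 (n + k)) (h (n + k))
        (fun hk => hx (hback h n k hk)) h1 h2
  let A : ℕ → P → Set (MarkovShift (transitionMatrix g P)) := fun n j =>
    {ω | Follows g ω x ∧ ω.1 n = j ∧ g^[n] x ∉ arcInterior (ω.1 n : Set G) ∧
      ∀ m < n, g^[m] x ∈ arcInterior (ω.1 m : Set G)}
  let B : Set (MarkovShift (transitionMatrix g P)) :=
    {ω | Follows g ω x ∧ ∀ m, g^[m] x ∈ arcInterior (ω.1 m : Set G)}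
  have hA : ∀ n j, (A n j).Subsingleton := by
    rintro n j ω ⟨h, hn, hx, hm⟩ ω' ⟨h', hn', -, -⟩
    refine Subtype.ext (funext fun m => ?_)
    rcases lt_or_ge m n with hlt | hge
    · exact hint h h' m (hm m hlt)
    · obtain ⟨k, rfl⟩ := Nat.exists_eq_add_of_le hge
      exact hfwd h h' n (hn.trans hn'.symm) hx k
  have hB : B.Subsingleton := fun ω h ω' h' =>
    Subtype.ext (funext fun m => hint h.1 h'.1 m (h.2 m))
  refine (hB.countable.union (countable_iUnion fun n => countable_iUnion fun j =>
    (hA n j).countable)).mono fun ω hω => ?_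
  by_cases h : ∀ m, g^[m] x ∈ arcInterior (ω.1 m : Set G)
  · exact Or.inl ⟨hω, h⟩
  · classical
    push Not at h
    refine Or.inr (mem_iUnion₂.2 ⟨Nat.find h, ω.1 (Nat.find h), hω, rfl, Nat.find_spec h,
      fun m hm => not_not.1 (Nat.find_min h hm)⟩)

theorem isClosed_cylinder [T2Space G] (hg : Continuous g)
    (ω : MarkovShift (transitionMatrix g P)) (n : ℕ) : IsClosed (cylinder g ω n) := by
  simp only [cylinder, ofPred_forall]
  refine isClosed_iInter fun m => isClosed_iInter fun _ => IsClosed.preimage (hg.iterate m) ?_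
  have : (ω.1 m : Set G) = range (hP.tame.param (ω.1 m)) := by
    ext x
    exact ⟨hP.tame.exists_param_eq, fun ⟨t, ht⟩ => ht ▸ hP.tame.param_mem _ t⟩
  rw [this]
  exact (isCompact_range (hP.tame.continuous_param _)).isClosed

theorem exists_follows [T2Space G] [CompactSpace G] (hg : Continuous g)
    (ω : MarkovShift (transitionMatrix g P)) : ∃ x, Follows g ω x := by
  obtain ⟨x, hx⟩ := IsCompact.nonempty_iInter_of_sequence_nonempty_isCompact_isClosed
    (cylinder g ω) (fun n => antitone_cylinder ω n.le_succ)
    (cylinder_nonempty (fun i => ⟨_, hP.tame.param_mem i 0⟩) ω)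
    (hP.isClosed_cylinder hg ω 0).isCompact (hP.isClosed_cylinder hg ω)
  exact ⟨x, follows_iff_mem_iInter.2 hx⟩

/-- In the parameter of the first arc, the points following `ω` form an interval. -/
theorem follows_of_mem_uIcc [T2Space G] (hg : Continuous g)
    {ω : MarkovShift (transitionMatrix g P)} {s t u : unitInterval}
    (hs : Follows g ω (hP.tame.param (ω.1 0) s)) (ht : Follows g ω (hP.tame.param (ω.1 0) t))
    (hu : u ∈ uIcc s t) : Follows g ω (hP.tame.param (ω.1 0) u) := by
  intro n
  induction n generalizing ω s t u with
  | zero => exact hP.tame.param_mem _ u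
  | succ n ih =>
    obtain ⟨φ, hφc, hφi, hφ⟩ := hP.exists_branch hg (ω.2 0)
    obtain ⟨s', hs'⟩ := hP.tame.exists_param_eq (hs 1)
    obtain ⟨t', ht'⟩ := hP.tame.exists_param_eq (ht 1)
    have es : φ s' = s := (hφ s' s).2 hs'.symm
    have et : φ t' = t := (hφ t' t).2 ht'.symm
    rw [← es, ← et] at hu
    -- By the intermediate value theorem for the inverse branch, the image of the point at `u` lies
    -- between the images of the two ends.
    obtain ⟨u', hu', rfl⟩ := intermediate_value_uIcc hφc.continuousOn hu
    have hgu := (hφ u' _).1 rfl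
    rw [Function.iterate_succ_apply, hgu]
    refine ih (ω := shiftMap _ ω) (s := s') (t := t') ?_ ?_ hu'
    · exact hs' ▸ hs.shift
    · exact ht' ▸ ht.shift

theorem iterate_ne_of_follows {ω : MarkovShift (transitionMatrix g P)} {x y : G}
    (hx : Follows g ω x) (hy : Follows g ω y) (hxy : x ≠ y) (n : ℕ) : g^[n] x ≠ g^[n] y := by
  induction n with
  | zero => exact hxy
  | succ n ih =>
    rw [Function.iterate_succ_apply', Function.iterate_succ_apply']
    exact fun h => ih (hP.injOn (ω.1 n) (hx n) (hy n) h)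

/-- An injective interval map cannot be mixing on a nondegenerate interval. -/
theorem not_follows_const [T2Space G] (hg : Continuous g) (hmix : IsMixing g)
    {ω : MarkovShift (transitionMatrix g P)} (hω : ∀ n, ω.1 n = ω.1 0) {a b : unitInterval}
    (hab : a < b) (ha : Follows g ω (hP.tame.param (ω.1 0) a)) :
    ¬ Follows g ω (hP.tame.param (ω.1 0) b) := by
  intro hb
  have hcst : shiftMap _ ω = ω := Subtype.ext (funext fun n => (hω _).trans (hω n).symm)
  set e := hP.tame.param (ω.1 0) with he
  have hM : transitionMatrix g P (ω.1 0) (ω.1 0) = 1 := by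
    have := ω.2 0
    rwa [hω (0 + 1)] at this
  obtain ⟨φ, hφc, hφi, hφ⟩ := hP.exists_branch hg hM
  -- `φ` may reverse orientation; its square cannot, so only even times are considered.
  have hmono : StrictMono (φ ∘ φ) := by
    rcases hφc.strictMono_of_inj hφi with h | h
    · exact h.comp h
    · exact h.comp h
  have hstep : ∀ z, Follows g ω (e z) → ∃ w, Follows g ω (e w) ∧ g^[2] (e z) = e w ∧
      φ (φ w) = z := by
    have h1 : ∀ z, Follows g ω (e z) → ∃ w, Follows g ω (e w) ∧ g (e z) = e w ∧ φ w = z := by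
      intro z hz
      have hz' := hz.shift
      rw [hcst] at hz'
      obtain ⟨w, hw⟩ := hP.tame.exists_param_eq (hz' 0)
      exact ⟨w, by rw [he, hw]; exact hz', hw.symm, (hφ w z).2 hw.symm⟩
    intro z hz
    obtain ⟨w, hw, hzw, hwz⟩ := h1 z hz
    obtain ⟨v, hv, hwv, hvw⟩ := h1 w hw
    exact ⟨v, hv, by rw [← hwv, ← hzw]; rfl, by rw [hvw, hwz]⟩
  obtain ⟨p, hap, hpb⟩ := exists_between hab
  have hbetween : ∀ u ∈ Icc a b, Follows g ω (e u) := fun u hu =>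
    hP.follows_of_mem_uIcc hg ha hb (by rwa [uIcc_of_le hab.le])
  have hsub1 : Ioo a p ⊆ Ioo 0 1 := fun u hu =>
    ⟨a.2.1.trans_lt hu.1, hu.2.trans_le p.2.2⟩
  have hsub2 : Ioo p b ⊆ Ioo 0 1 := fun u hu =>
    ⟨p.2.1.trans_lt hu.1, hu.2.trans_le b.2.2⟩
  have ho1 := hP.tame.isOpen_param_image (ω.1 0) isOpen_Ioo hsub1
  have ho2 := hP.tame.isOpen_param_image (ω.1 0) isOpen_Ioo hsub2
  have hn1 := (nonempty_Ioo.2 hap).image e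
  have hn2 := (nonempty_Ioo.2 hpb).image e
  have hiter : ∀ S : Set unitInterval,
      (∀ z ∈ S, ∀ w, φ (φ w) = z → w ∈ S) → ∀ n : ℕ, ∀ z ∈ S, Follows g ω (e z) →
      ∃ w ∈ S, g^[2 * n] (e z) = e w := by
    intro S hS n
    induction n with
    | zero => exact fun z hz _ => ⟨z, hz, rfl⟩
    | succ n ih =>
      intro z hz hzf
      obtain ⟨w, hw, hzw, hwz⟩ := hstep z hzf
      obtain ⟨v, hv, hwv⟩ := ih w (hS z hz w hwz) hw
      refine ⟨v, hv, ?_⟩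
      rw [Nat.mul_succ, Function.iterate_add_apply, hzw, hwv]
  have hinje := hP.tame.injective_param (ω.1 0)
  -- `q` is the parameter of `g^[2]` at `p`. If `p ≤ q`, followers to the right of `p` stay there at
  -- even times and never enter the left half; the other case is symmetric.
  obtain ⟨q, -, -, hqp⟩ := hstep p (hbetween p ⟨hap.le, hpb.le⟩)
  rcases le_total p q with hpq | hqp'
  · obtain ⟨N, hN⟩ := hmix _ _ ho2 ho1 hn2 hn1
    obtain ⟨_, ⟨_, ⟨z, hz, rfl⟩, rfl⟩, v, hv, hvz⟩ := hN (2 * N) (by omega)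
    obtain ⟨w, hw, hzw⟩ := hiter (Ici p)
      (fun z hz w hw => hpq.trans (hmono.le_iff_le.1 (by
        rw [Function.comp_apply, Function.comp_apply, hqp, hw]; exact hz))) N z hz.1.le
      (hbetween z ⟨hap.le.trans hz.1.le, hz.2.le⟩)
    obtain rfl := hinje (hvz.trans hzw)
    exact absurd hv.2 (not_lt.2 hw)
  · obtain ⟨N, hN⟩ := hmix _ _ ho1 ho2 hn1 hn2
    obtain ⟨_, ⟨_, ⟨z, hz, rfl⟩, rfl⟩, v, hv, hvz⟩ := hN (2 * N) (by omega)
    obtain ⟨w, hw, hzw⟩ := hiter (Iic p)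
      (fun z hz w hw => (hmono.le_iff_le.1 (by
        rw [Function.comp_apply, Function.comp_apply, hqp, hw]; exact hz)).trans hqp') N z hz.2.le
      (hbetween z ⟨hz.1.le, hz.2.le.trans hpb.le⟩)
    obtain rfl := hinje (hvz.trans hzw)
    exact absurd hv.1 (not_lt.2 hw)

theorem follows_unique [T2Space G] (hg : Continuous g) (hmix : IsMixing g)
    {ω : MarkovShift (transitionMatrix g P)} {x y : G} (hx : Follows g ω x)
    (hy : Follows g ω y) : x = y := by
  have wlog : ∀ {ω : MarkovShift (transitionMatrix g P)} {x y : G}, Follows g ω x →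
      Follows g ω y → x ≠ y → ∃ s t, s < t ∧ Follows g ω (hP.tame.param (ω.1 0) s) ∧
      Follows g ω (hP.tame.param (ω.1 0) t) := by
    intro ω x y hx hy hxy
    obtain ⟨s, rfl⟩ := hP.tame.exists_param_eq (hx 0)
    obtain ⟨t, rfl⟩ := hP.tame.exists_param_eq (hy 0)
    rcases lt_or_gt_of_ne (fun h : s = t => hxy (by rw [h])) with h | h
    · exact ⟨s, t, h, hx, hy⟩
    · exact ⟨t, s, h, hy, hx⟩
  by_contra hxy
  obtain ⟨s, t, hst, hs, ht⟩ := wlog hx hy hxy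
  have hsub : Ioo s t ⊆ Ioo 0 1 := fun u hu => ⟨s.2.1.trans_lt hu.1, hu.2.trans_le t.2.2⟩
  have hO := hP.tame.isOpen_param_image (ω.1 0) isOpen_Ioo hsub
  have hne := (nonempty_Ioo.2 hst).image (hP.tame.param (ω.1 0))
  obtain ⟨N, hN⟩ := hmix _ _ hO hO hne hne
  -- A point returning at time `n` lies in the arc `ω n` and in the interior of the arc `ω 0`.
  have hω : ∀ n ≥ N, ω.1 n = ω.1 0 := by
    intro n hn
    obtain ⟨_, ⟨_, ⟨u, hu, rfl⟩, rfl⟩, v, hv, hvu⟩ := hN n hn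
    refine hP.tame.eq_of_mem_of_mem_arcInterior (hP.follows_of_mem_uIcc hg hs ht
      (by rw [uIcc_of_le hst.le]; exact Ioo_subset_Icc_self hu) n) ?_
    rw [← hvu, hP.tame.param_mem_arcInterior]
    exact hsub hv
  obtain ⟨a, b, hab, ha, hb⟩ := wlog (Follows.iterate hx N) (Follows.iterate hy N)
    (hP.iterate_ne_of_follows hx hy hxy N)
  refine hP.not_follows_const hg hmix (fun n => ?_) hab ha hb
  rw [iterate_shiftMap_apply, iterate_shiftMap_apply, hω _ (Nat.le_add_left _ _),
    hω _ (Nat.le_add_left _ _)]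

theorem exists_follows_of_forall_mem {x : G}
    (hx : ∀ n, g^[n] x ∈ ⋃ i : P, arcInterior (i : Set G)) :
    ∃ ω : MarkovShift (transitionMatrix g P), Follows g ω x := by
  simp only [mem_iUnion] at hx
  choose ω hω using hx
  refine ⟨⟨ω, fun n => hP.transitionMatrix_eq_one_of_mem (hω n).1 ?_⟩, fun n => (hω n).1⟩
  rw [← Function.iterate_succ_apply' g]
  exact hω (n + 1)

theorem mem_arcInterior_of_follows {ω : MarkovShift (transitionMatrix g P)} {x : G} {n : ℕ}
    (h : Follows g ω x) (hx : g^[n] x ∈ ⋃ i : P, arcInterior (i : Set G)) :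
    g^[n] x ∈ arcInterior (ω.1 n : Set G) := by
  obtain ⟨i, hi⟩ := mem_iUnion.1 hx
  rwa [hP.tame.eq_of_mem_of_mem_arcInterior (h n) hi]

end IsCountableMarkovPartition

end Markov

/-! ### Topology of the shift space -/

section ShiftTopology

variable {I : Type*} {M : Matrix I I ℕ}

theorem isOpen_setOf_coord_eq (n : ℕ) (j : I) : IsOpen {ω : MarkovShift M | ω.1 n = j} := by
  let _ : TopologicalSpace I := ⊥
  have : DiscreteTopology I := ⟨rfl⟩
  have h : Continuous fun ω : MarkovShift M => ω.1 n :=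
    (continuous_apply n).comp continuous_induced_dom
  exact (isOpen_discrete {j}).preimage h

theorem continuous_markovShift {X : Type*} [TopologicalSpace X] {f : X → MarkovShift M}
    (h : ∀ n j, IsOpen {x | (f x).1 n = j}) : Continuous f := by
  let _ : TopologicalSpace I := ⊥
  have : DiscreteTopology I := ⟨rfl⟩
  exact continuous_induced_rng.2 (continuous_pi fun n => continuous_discrete_rng.2 fun j => h n j)

end ShiftTopology

/-! ### Exceptional sets and the isomorphism -/

/-- The set of points whose orbit meets the forward orbit of a point of `S`. -/
def grandOrbit {X : Type*} (f : X → X) (S : Set X) : Set X :=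
  ⋃ (m : ℕ) (n : ℕ), f^[m] ⁻¹' (f^[n] '' S)

theorem preimage_grandOrbit {X : Type*} (f : X → X) (S : Set X) :
    f ⁻¹' grandOrbit f S = grandOrbit f S := by
  ext x
  simp only [grandOrbit, mem_preimage, mem_iUnion, mem_image]
  constructor
  · rintro ⟨m, n, q, hq, h⟩
    exact ⟨m + 1, n, q, hq, h⟩
  · rintro ⟨m, n, q, hq, h⟩
    refine ⟨m, n + 1, q, hq, ?_⟩
    rw [Function.iterate_succ_apply', h, ← Function.iterate_succ_apply' f,
      Function.iterate_succ_apply]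

theorem iterate_notMem_of_notMem_grandOrbit {X : Type*} {f : X → X} {S : Set X} {x : X}
    (hx : x ∉ grandOrbit f S) (n : ℕ) : f^[n] x ∉ S := fun h =>
  hx (mem_iUnion₂.2 ⟨n, 0, f^[n] x, h, rfl⟩)

theorem IsCountableMarkovPartition.isomorphicModCountable {G : Type*} [TopologicalSpace G]
    [T2Space G] [CompactSpace G] {g : G → G} {P : Set (Set G)} (hg : Continuous g)
    (hmix : IsMixing g) (hP : IsCountableMarkovPartition g P) :
    IsomorphicModCountable g (shiftMap (transitionMatrix g P)) := by
  choose π hπ using hP.exists_follows hg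
  have hπu : ∀ {ω x}, Follows g ω x → π ω = x := fun h => hP.follows_unique hg hmix (hπ _) h
  have hconj : ∀ ω, π (shiftMap _ ω) = g (π ω) := fun ω => hπu (hπ ω).shift
  have hcont : Continuous π := by
    refine continuous_iff_continuousAt.2 fun ω U hU => ?_
    -- The closed cylinders decrease to the single point `π ω`, so one of them lies in `U`.
    obtain ⟨n, hn⟩ := exists_subset_nhds_of_compactSpace (V := cylinder g ω)
      (antitone_cylinder ω).directed_ge (hP.isClosed_cylinder hg ω) (U := U)
      (fun x hx => hπu (follows_iff_mem_iInter.2 hx) ▸ hU)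
    have hW : (⋂ m ∈ Finset.range (n + 1), {ω' : MarkovShift (transitionMatrix g P) |
        ω'.1 m = ω.1 m}) ∈ 𝓝 ω :=
      (isOpen_biInter_finset fun m _ => isOpen_setOf_coord_eq m _).mem_nhds
        (mem_iInter₂.2 fun m _ => rfl)
    rw [mem_map]
    refine mem_of_superset hW fun ω' hω' => hn fun m hm => ?_
    have h := mem_iInter₂.1 hω' m (Finset.mem_range.2 (Nat.lt_succ_of_le hm))
    exact (h : ω'.1 m = ω.1 m) ▸ hπ ω' m
  set Q : Set G := (⋃ i : P, arcInterior (i : Set G))ᶜ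
  have hQ : Q.Countable := hP.tame.countable_compl_iUnion_arcInterior
  -- Iterated preimages of `Q` alone need not be forward invariant; the grand orbit is totally
  -- invariant.
  set N := grandOrbit g Q
  have hN : N.Countable := countable_iUnion fun m => countable_iUnion fun n =>
    hP.countable_iterate_preimage (hQ.image _) m
  have hgN : g ⁻¹' N = N := preimage_grandOrbit g Q
  have hreg : ∀ {x}, x ∉ N → ∀ n, g^[n] x ∈ ⋃ i : P, arcInterior (i : Set G) := fun hx n =>
    not_not.1 (iterate_notMem_of_notMem_grandOrbit hx n)
  have hσ : shiftMap (transitionMatrix g P) ⁻¹' (π ⁻¹' N) = π ⁻¹' N := by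
    ext ω
    rw [mem_preimage, mem_preimage, hconj, mem_preimage]
    exact Set.ext_iff.1 hgN (π ω)
  have hN₂ : (π ⁻¹' N).Countable :=
    (hN.biUnion fun x _ => hP.countable_follows hg x).mono fun ω hω =>
      mem_iUnion₂.2 ⟨π ω, hω, hπ ω⟩
  let Φ : ((π ⁻¹' N)ᶜ : Set (MarkovShift (transitionMatrix g P))) → (Nᶜ : Set G) :=
    fun ω => ⟨π ω, ω.2⟩
  have hΦ : Function.Bijective Φ := by
    constructor
    · intro ω ω' h
      have h' : π ω = π ω' := congrArg Subtype.val h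
      refine Subtype.ext (Subtype.ext (funext fun n => ?_))
      exact hP.tame.eq_of_mem_of_mem_arcInterior (hπ ω n)
        (h' ▸ hP.mem_arcInterior_of_follows (hπ ω') (hreg ω'.2 n))
    · intro x
      obtain ⟨ω, hω⟩ := hP.exists_follows_of_forall_mem (hreg x.2)
      have := hπu hω
      exact ⟨⟨ω, fun h => x.2 (this ▸ h)⟩, Subtype.ext this⟩
  let Ψ := Equiv.ofBijective Φ hΦ
  have hπΨ : ∀ x, π (Ψ.symm x).1 = x.1 := fun x => congrArg Subtype.val (Ψ.apply_symm_apply x)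
  have hΦc : Continuous Φ := (hcont.comp continuous_subtype_val).subtype_mk _
  have hΨc : Continuous Ψ.symm := by
    refine continuous_induced_rng.2 (continuous_markovShift fun n j => ?_)
    -- Off `N` the `n`-th symbol is `j` exactly when the `n`-th iterate lies in the open set `j°`,
    -- so the inverse is continuous.
    have : {x : (Nᶜ : Set G) | (Ψ.symm x).1.1 n = j} =
        (fun x : (Nᶜ : Set G) => g^[n] x) ⁻¹' arcInterior (j : Set G) := by
      ext x
      have hx := hP.mem_arcInterior_of_follows (n := n) (hπ (Ψ.symm x).1)
        (by rw [hπΨ]; exact hreg x.2 n)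
      have hf := hπ (Ψ.symm x).1 n
      rw [hπΨ] at hx hf
      exact ⟨fun h => (h : _ = j) ▸ hx, hP.tame.eq_of_mem_of_mem_arcInterior hf⟩
    have hopen := (hP.tame.isOpen_arcInterior j).preimage
      ((hg.iterate n).comp (continuous_subtype_val (p := (· ∈ Nᶜ))))
    exact this ▸ hopen
  refine ⟨N, π ⁻¹' N, hgN, hσ, Ψ.symm, hN, hN₂, ?_, ?_, ?_⟩
  · exact hΨc.borel_measurable
  · exact hΦc.borel_measurable
  · funext x
    refine Ψ.injective (Subtype.ext ?_)
    rw [Function.comp_apply, Function.comp_apply, Ψ.apply_symm_apply]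
    exact (hconj _).trans (congrArg g (hπΨ x))

end TameGraph

theorem mainTheorem6 {G : Type*} [MetricSpace G] (hG : TameGraph.IsTameGraph G)
    (g : G → G) (hg : Continuous g) (hmix : TameGraph.IsMixing g)
    (P : Set (Set G)) (hP : TameGraph.IsCountableMarkovPartition g P) :
    TameGraph.IsomorphicModCountable g
      (TameGraph.shiftMap (TameGraph.transitionMatrix g P)) := by
  have := hG.1
  exact hP.isomorphicModCountable hg hmix
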